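/- Let $\Gamma$ be a finitely presented group, let $S\subseteq\Gamma$ be a finite generating set, let $E$ be a real or complex Banach space, and let $\pi$ be a representation of $\Gamma$ on $E$, that is, a homomorphism from $\Gamma$ to the group of bounded linear automorphisms of $E$ (no uniform bound on $\|\pi_\gamma\|$ is assumed). Let $Z^2(\Gamma,\pi)$ be the space of $2$-cocycles of the standard inhomogeneous complex, i.e. of functions $c:\Gamma\times\Gamma\to E$ with $\pi_g c(h,k)-c(gh,k)+c(g,hk)-c(g,h)=0$ for all $g,h,k\in\Gamma$, with the topology of pointwise convergence, and let $B^2(\Gamma,\pi)\subseteq Z^2(\Gamma,\pi)$ be the space of coboundaries $(g,h)\mapsto \pi_g b(h)-b(gh)+b(g)$, $b:\Gamma\to E$. The cohomology $H^2(\Gamma,\pi)=Z^2(\Gamma,\pi)/B^2(\Gamma,\pi)$ is called reduced if the canonical map onto the reduced cohomology $\overline{H}^2(\Gamma,\pi)=Z^2(\Gamma,\pi)/\overline{B^2(\Gamma,\pi)}$ is an isomorphism (equivalently, if $B^2(\Gamma,\pi)$ is closed). For $\varepsilon>0$, a representation $\rho$ of $\Gamma$ on the same space $E$ is an $\varepsilon$-deformation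 of $\pi$ if $\sup_{s\in S}\|\pi_s-\rho_s\|_{B(E)}\le\varepsilon$. An affine action of $\Gamma$ on $E$ has linear part $\pi$ if each $g\in\Gamma$ acts by $v\mapsto \pi_g v+b(g)$ for some $b(g)\in E$; a fixed point of the action is a point of $E$ fixed by every $g\in\Gamma$. **Theorem.** Assume that $H^2(\Gamma,\pi)$ is reduced and that every affine action of $\Gamma$ on $E$ with linear part $\pi$ has a fixed point. Then there exists $\varepsilon=\varepsilon(\Gamma,S,\pi)>0$ such that, for every $\varepsilon$-deformation $\rho$ of $\pi$, every affine action of $\Gamma$ on $E$ with linear part $\rho$ has a fixed point. -/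

import Mathlib

section BanachRepresentations

variable {Γ : Type*} [Group Γ] {𝕜 : Type*} [RCLike 𝕜]
  {E : Type*} [NormedAddCommGroup E] [NormedSpace 𝕜 E]

/-- Representations of `Γ` on the Banach space `E`: homomorphisms into the group of bounded
linear automorphisms of `E`. No uniform bound on `‖π γ‖` is required. -/
abbrev BanachRep (Γ : Type*) [Group Γ] (𝕜 : Type*) [RCLike 𝕜]
    (E : Type*) [NormedAddCommGroup E] [NormedSpace 𝕜 E] : Type _ :=
  Γ →* (E ≃L[𝕜] E)

/-- `ρ` is an `ε`-deformation of `π` with respect to `S`: the operator norm of `π s - ρ s`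
is at most `ε` for every `s ∈ S`. -/
def IsDeformation (S : Set Γ) (ε : ℝ) (π ρ : BanachRep Γ 𝕜 E) : Prop :=
  ∀ s ∈ S, ‖(π s : E →L[𝕜] E) - (ρ s : E →L[𝕜] E)‖ ≤ ε

/-- The affine action `A` of `Γ` on `E` has linear part `π`. -/
def HasLinearPart (A : Γ →* (E ≃ᵃ[𝕜] E)) (π : BanachRep Γ 𝕜 E) : Prop :=
  ∀ g : Γ, (A g).linear = (π g).toLinearEquiv

/-- Every affine action of `Γ` on `E` with linear part `π` has a fixed point. -/
def AffineFixedPointProperty (π : BanachRep Γ 𝕜 E) : Prop :=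
  ∀ A : Γ →* (E ≃ᵃ[𝕜] E), HasLinearPart A π → ∃ v : E, ∀ g : Γ, A g v = v

/-- The differential `C¹(Γ, π) → C²(Γ, π)` of the standard (inhomogeneous bar) complex,
`(d b)(g, h) = π g (b h) - b (g h) + b g`. -/
def groupD₁ (π : BanachRep Γ 𝕜 E) : (Γ → E) →ₗ[𝕜] (Γ × Γ → E) where
  toFun b := fun p => π p.1 (b p.2) - b (p.1 * p.2) + b p.1
  map_add' b c := by
    funext p
    simp only [Pi.add_apply, map_add]
    abel
  map_smul' r b := by
    funext p
    simp only [Pi.smul_apply, map_smul, RingHom.id_apply, smul_add, smul_sub]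

/-- The differential `C²(Γ, π) → C³(Γ, π)` of the standard complex,
`(d c)(g, h, k) = π g (c (h, k)) - c (g h, k) + c (g, h k) - c (g, h)`. -/
def groupD₂ (π : BanachRep Γ 𝕜 E) : (Γ × Γ → E) →ₗ[𝕜] (Γ × Γ × Γ → E) where
  toFun c := fun p => π p.1 (c (p.2.1, p.2.2)) - c (p.1 * p.2.1, p.2.2)
    + c (p.1, p.2.1 * p.2.2) - c (p.1, p.2.1)
  map_add' b c := by
    funext p
    simp only [Pi.add_apply, map_add]
    abel
  map_smul' r b := by
    funext p
    simp only [Pi.smul_apply, map_smul, RingHom.id_apply, smul_add, smul_sub]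

/-- The space `Z²(Γ, π)` of 2-cocycles, with the topology of pointwise convergence
(as a subspace of the product `E ^ (Γ × Γ)`). -/
def groupZ₂ (π : BanachRep Γ 𝕜 E) : Submodule 𝕜 (Γ × Γ → E) :=
  LinearMap.ker (groupD₂ π)

theorem groupD₁_mem_groupZ₂ (π : BanachRep Γ 𝕜 E) (b : Γ → E) : groupD₁ π b ∈ groupZ₂ π := by
  rw [groupZ₂, LinearMap.mem_ker]
  funext p
  have h : π (p.1 * p.2.1) (b p.2.2) = π p.1 (π p.2.1 (b p.2.2)) := by
    rw [map_mul]
    rfl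
  simp only [groupD₁, groupD₂, LinearMap.coe_mk, AddHom.coe_mk, map_add, map_sub, h,
    mul_assoc, Pi.zero_apply]
  abel

/-- The space `B²(Γ, π)` of 2-coboundaries, inside the space of 2-cocycles. -/
def groupB₂ (π : BanachRep Γ 𝕜 E) : Submodule 𝕜 (groupZ₂ π) :=
  LinearMap.range ((groupD₁ π).codRestrict (groupZ₂ π) (groupD₁_mem_groupZ₂ π))

/-- Group cohomology `H²(Γ, π) = Z² / B²`. -/
abbrev GroupH₂ (π : BanachRep Γ 𝕜 E) : Type _ :=
  groupZ₂ π ⧸ groupB₂ π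

/-- Reduced cohomology, the quotient of `Z²` by the closure of `B²`. -/
abbrev ReducedGroupH₂ (π : BanachRep Γ 𝕜 E) : Type _ :=
  groupZ₂ π ⧸ (groupB₂ π).topologicalClosure

/-- `H²(Γ, π)` is reduced: the canonical surjection from `H²(Γ, π)` onto the reduced cohomology
is an isomorphism, that is, it is injective. -/
def IsReducedGroupH₂ (π : BanachRep Γ 𝕜 E) : Prop :=
  Function.Injective
    (Submodule.factor (groupB₂ π).le_topologicalClosure : GroupH₂ π →ₗ[𝕜] ReducedGroupH₂ π)

end BanachRepresentations

/-!
Affine actions with linear part `ρ` are the same as crossed homomorphisms (1-cocycles) `b : Γ → E`,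
and a fixed point exists exactly when `b` is principal. Fix a presentation of `Γ` with finitely many
generators `X` and finitely many relators `R`. A crossed homomorphism is determined by its values on
`X`, and a family `x : X → E` comes from one exactly when the Fox derivatives of all relators vanish
at `x`. Thus vanishing of `H¹(Γ, ρ)` is exactness in the middle of the complex of Banach spaces

  `E --A--> (X → E) --B--> (R → E)`,   `A v i = ρ i v - v`,   `B x r = (∂ r) x`,

where `A` and `B` depend continuously on `ρ`, in operator norm, through the values of `ρ` on any
generating set.

If `H²(Γ, π)` is reduced then the operator `B` of `π` has closed range
(`isClosed_range_relatorOperator`). Indeed, if `B xₖ → y`, then the crossed homomorphisms of the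
free group defined by the `xₖ`, restricted to the kernel `N` of `FreeGroup X → Γ`, are equivariant
homomorphisms that converge pointwise on the normal generators `R`, hence on all of `N`, to some
`φ`. For a section `σ` the 2-cocycle `φ (σ g * σ h * (σ (g * h))⁻¹)` is a limit of coboundaries,
hence is a coboundary, and this says that `φ` extends to a crossed homomorphism of the free group,
whose values on `X` form a preimage of `y`.

Exactness in the middle of a complex of Banach spaces whose second map has closed range is stable
under small perturbations within complexes (`exists_forall_exact_of_close`): by the open mapping
theorem every element of the perturbed kernel is approximated, up to half its norm, by the perturbed
image of a vector of controlled norm, and the error is again in the perturbed kernel, so that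
one can iterate.
-/

/-! ### Stability of exactness -/

section Stability

variable {𝕜 : Type*} [RCLike 𝕜]
  {E : Type*} [NormedAddCommGroup E] [NormedSpace 𝕜 E] [CompleteSpace E]
  {F : Type*} [NormedAddCommGroup F] [NormedSpace 𝕜 F]
  {G : Type*} [NormedAddCommGroup G] [NormedSpace 𝕜 G]

/-- The open mapping theorem for an operator with closed range. -/
theorem exists_preimage_norm_le_of_isClosed_range [CompleteSpace F] (f : E →L[𝕜] F)
    (hf : IsClosed (Set.range f)) :
    ∃ C : ℝ, 0 < C ∧ ∀ x : E, ∃ x' : E, f x' = f x ∧ ‖x'‖ ≤ C * ‖f x‖ := by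
  have hcl : IsClosed (f.range : Set F) := hf
  have : CompleteSpace f.range := hcl.completeSpace_coe
  obtain ⟨C, hC, h⟩ := f.rangeRestrict.exists_preimage_norm_le
    (fun ⟨_, x, hx⟩ => ⟨x, Subtype.ext hx⟩)
  refine ⟨C, hC, fun x => ?_⟩
  obtain ⟨x', hx', hn⟩ := h (f.rangeRestrict x)
  exact ⟨x', congrArg Subtype.val hx', hn⟩

/-- Approximate solvability of `f v = x` on an invariant set of right-hand sides, with error at most
half of the norm, implies solvability. -/
theorem exists_eq_of_approx (f : E →L[𝕜] F) (K : Set F) (C : ℝ)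
    (h : ∀ x ∈ K, ∃ v : E, ‖v‖ ≤ C * ‖x‖ ∧ x - f v ∈ K ∧ ‖x - f v‖ ≤ 1 / 2 * ‖x‖)
    {x : F} (hx : x ∈ K) : ∃ v : E, f v = x := by
  choose! s hs hsK hs2 using h
  let u : ℕ → F := fun n => (fun y => y - f (s y))^[n] x
  have u0 : u 0 = x := rfl
  have us : ∀ n, u (n + 1) = u n - f (s (u n)) := fun n => Function.iterate_succ_apply' _ _ _
  have uK : ∀ n, u n ∈ K := by
    intro n
    induction n with
    | zero => exact hx
    | succ n ih => rw [us]; exact hsK _ ih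
  have un : ∀ n, ‖u n‖ ≤ (1 / 2) ^ n * ‖x‖ := by
    intro n
    induction n with
    | zero => simp [u0]
    | succ n ih =>
      rw [us]
      calc _ ≤ 1 / 2 * ‖u n‖ := hs2 _ (uK n)
        _ ≤ 1 / 2 * ((1 / 2) ^ n * ‖x‖) := by gcongr
        _ = _ := by ring
  have hgeom : Summable fun n : ℕ => |C| * ((1 / 2 : ℝ) ^ n * ‖x‖) :=
    ((summable_geometric_of_lt_one (by norm_num) (by norm_num)).mul_right _).mul_left _
  have hsum : Summable fun n => s (u n) := by
    refine Summable.of_norm_bounded hgeom fun n => (hs _ (uK n)).trans ?_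
    calc C * ‖u n‖ ≤ |C| * ‖u n‖ := by gcongr; exact le_abs_self C
      _ ≤ _ := by gcongr; exact un n
  have hu0 : Filter.Tendsto u Filter.atTop (nhds 0) := by
    refine squeeze_zero_norm un ?_
    simpa using (tendsto_pow_atTop_nhds_zero_of_lt_one (r := (1 / 2 : ℝ)) (by norm_num)
      (by norm_num)).mul_const ‖x‖
  have htel : ∀ n, ∑ i ∈ Finset.range n, f (s (u i)) = x - u n := by
    intro n
    induction n with
    | zero => simp [u0]
    | succ n ih => rw [Finset.sum_range_succ, ih, us]; abel
  refine ⟨∑' n, s (u n), ?_⟩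
  have h1 := (hsum.hasSum.mapL f).tendsto_sum_nat
  simp only [htel] at h1
  refine tendsto_nhds_unique h1 ?_
  simpa using tendsto_const_nhds.sub hu0

/-- If `E → F → G` is exact at `F` and the second map has closed range, then every complex that is
close enough to it is exact at `F`. -/
theorem exists_forall_exact_of_close [CompleteSpace F] [CompleteSpace G]
    (A : E →L[𝕜] F) (B : F →L[𝕜] G) (hexact : ∀ x, B x = 0 ↔ ∃ v, A v = x)
    (hB : IsClosed (Set.range B)) :
    ∃ δ : ℝ, 0 < δ ∧ ∀ (A' : E →L[𝕜] F) (B' : F →L[𝕜] G),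
      (∀ v, ‖A v - A' v‖ ≤ δ * ‖v‖) → (∀ x, ‖B x - B' x‖ ≤ δ * ‖x‖) →
      (∀ v, B' (A' v) = 0) → ∀ x, B' x = 0 → ∃ v, A' v = x := by
  have hA : IsClosed (Set.range A) := by
    have : Set.range A = B ⁻¹' {0} := by
      ext x
      exact (hexact x).symm
    rw [this]
    exact isClosed_singleton.preimage B.continuous
  obtain ⟨a, ha, hA'⟩ := exists_preimage_norm_le_of_isClosed_range A hA
  obtain ⟨b, hb, hB'⟩ := exists_preimage_norm_le_of_isClosed_range B hB
  -- The errors below add up to at most `δ * (b + a + a * b)` times the norm.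
  refine ⟨1 / (2 * (b + a + a * b + 1)), by positivity, ?_⟩
  set δ : ℝ := 1 / (2 * (b + a + a * b + 1)) with hδ
  have hδ0 : 0 < δ := by positivity
  have hδM : δ * (b + a + a * b + 1) = 1 / 2 := by
    rw [hδ]; field_simp
  have hab : 0 < a * b := by positivity
  have hδ1 : δ ≤ 1 := by nlinarith
  intro A' B' hAA hBB hcomp x hx
  refine exists_eq_of_approx A' {x | B' x = 0} (a * (1 + b * δ)) ?_ hx
  intro x hx
  have hx : B' x = 0 := hx
  -- `z` is a short correction of `x` that moves it into the kernel of `B`.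
  obtain ⟨z, hz, hzn⟩ := hB' x
  have hBx : ‖B x‖ ≤ δ * ‖x‖ := by simpa [hx] using hBB x
  have hzn' : ‖z‖ ≤ b * δ * ‖x‖ := by
    calc ‖z‖ ≤ b * ‖B x‖ := hzn
      _ ≤ b * (δ * ‖x‖) := by gcongr
      _ = _ := by ring
  obtain ⟨w, hw⟩ := (hexact (x - z)).1 (by rw [map_sub, hz, sub_self])
  obtain ⟨v, hv, hvn⟩ := hA' w
  rw [hw] at hv hvn
  have hvn' : ‖v‖ ≤ a * (1 + b * δ) * ‖x‖ := by
    calc ‖v‖ ≤ a * ‖x - z‖ := hvn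
      _ ≤ a * (‖x‖ + b * δ * ‖x‖) := by
        gcongr
        exact (norm_sub_le _ _).trans (by gcongr)
      _ = _ := by ring
  refine ⟨v, hvn', ?_, ?_⟩
  · change B' (x - A' v) = 0
    rw [map_sub, hx, hcomp, sub_zero]
  · have hsplit : x - A' v = z + (A v - A' v) := by rw [hv]; abel
    calc ‖x - A' v‖ ≤ ‖z‖ + ‖A v - A' v‖ := by rw [hsplit]; exact norm_add_le _ _
      _ ≤ b * δ * ‖x‖ + δ * (a * (1 + b * δ) * ‖x‖) := by
        gcongr
        exact (hAA v).trans (by gcongr)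
      _ = δ * (b + a + a * b * δ) * ‖x‖ := by ring
      _ ≤ 1 / 2 * ‖x‖ := by
        gcongr
        rw [← hδM]
        refine mul_le_mul_of_nonneg_left ?_ hδ0.le
        nlinarith [mul_le_mul_of_nonneg_left hδ1 hab.le]

end Stability

/-! ### Crossed homomorphisms -/

section CrossedHom

variable {G : Type*} [Group G] {Γ : Type*} [Group Γ] {𝕜 : Type*} [RCLike 𝕜]
  {E : Type*} [NormedAddCommGroup E] [NormedSpace 𝕜 E]

/-- Crossed homomorphisms, that is, 1-cocycles of the inhomogeneous complex. -/
def IsCrossedHom (α : BanachRep G 𝕜 E) (b : G → E) : Prop :=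
  ∀ g h, b (g * h) = b g + α g (b h)

namespace IsCrossedHom

variable {α : BanachRep G 𝕜 E} {b : G → E}

theorem map_one (hb : IsCrossedHom α b) : b 1 = 0 := by
  have h := hb 1 1
  rw [one_mul, _root_.map_one] at h
  exact left_eq_add.1 h

theorem map_inv (hb : IsCrossedHom α b) (g : G) : b g⁻¹ = -α g⁻¹ (b g) := by
  have h := hb g⁻¹ g
  rw [inv_mul_cancel, hb.map_one] at h
  exact eq_neg_of_add_eq_zero_left h.symm

theorem map_mul_inv (hb : IsCrossedHom α b) (g h : G) :
    b (g * h⁻¹) = b g - α (g * h⁻¹) (b h) := by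
  rw [hb, hb.map_inv, map_neg, _root_.map_mul]
  exact (sub_eq_add_neg _ _).symm

theorem map_conj (hb : IsCrossedHom α b) (g : G) {n : G} (hn : α n = 1) :
    b (g * n * g⁻¹) = α g (b n) := by
  have h1 : α (g * n * g⁻¹) = 1 := by simp [hn]
  rw [hb.map_mul_inv, h1, hb]
  exact add_sub_cancel_left (b g) (α g (b n))

theorem comp {α : BanachRep Γ 𝕜 E} {b : Γ → E} (hb : IsCrossedHom α b) (p : G →* Γ) :
    IsCrossedHom (α.comp p) (b ∘ p) := fun g h => by
  simp only [Function.comp_apply, _root_.map_mul]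
  exact hb _ _

/-- The principal crossed homomorphism of a vector. -/
theorem principal (α : BanachRep G 𝕜 E) (v : E) : IsCrossedHom α fun g => α g v - v :=
  fun g h => by
    have : α (g * h) v = α g (α h v) := by rw [_root_.map_mul]; rfl
    simp only [this, map_sub]
    abel

theorem eq_of_eqOn_of {X : Type*} {α : BanachRep (FreeGroup X) 𝕜 E} {b c : FreeGroup X → E}
    (hb : IsCrossedHom α b) (hc : IsCrossedHom α c)
    (h : ∀ i, b (FreeGroup.of i) = c (FreeGroup.of i)) : b = c := by
  funext w
  induction w using FreeGroup.induction_on with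
  | C1 => rw [hb.map_one, hc.map_one]
  | of i => exact h i
  | inv_of i ih => rw [hb.map_inv, hc.map_inv, h]
  | mul x y hx hy => rw [hb, hc, hx, hy]

/-- On a normal subgroup acting trivially, the values of a family of crossed homomorphisms stay in
every invariant subgroup that contains the values on normal generators. -/
theorem mem_of_mem_normalClosure {ι : Type*} {b : ι → G → E} (hb : ∀ k, IsCrossedHom α (b k))
    (C : AddSubgroup (ι → E)) (hC : ∀ g, ∀ f ∈ C, (fun k => α g (f k)) ∈ C)
    {R : Set G} (htriv : ∀ n ∈ Subgroup.normalClosure R, α n = 1)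
    (hR : ∀ r ∈ R, (fun k => b k r) ∈ C) {n : G} (hn : n ∈ Subgroup.normalClosure R) :
    (fun k => b k n) ∈ C := by
  let N : Subgroup G :=
    { carrier := {g | α g = 1 ∧ (fun k => b k g) ∈ C}
      one_mem' := by
        refine ⟨_root_.map_one α, ?_⟩
        have : (fun k => b k 1) = (0 : ι → E) := funext fun k => (hb k).map_one
        rw [this]
        exact C.zero_mem
      mul_mem' := by
        rintro g h ⟨hg, hg'⟩ ⟨hh, hh'⟩
        refine ⟨by rw [_root_.map_mul, hg, hh, one_mul], ?_⟩
        have : (fun k => b k (g * h)) = (fun k => b k g) + fun k => b k h := by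
          funext k
          rw [(hb k) g h, hg]
          rfl
        rw [this]
        exact C.add_mem hg' hh'
      inv_mem' := by
        rintro g ⟨hg, hg'⟩
        refine ⟨by rw [_root_.map_inv, hg, inv_one], ?_⟩
        have : (fun k => b k g⁻¹) = -fun k => b k g := by
          funext k
          rw [(hb k).map_inv, _root_.map_inv, hg, inv_one]
          rfl
        rw [this]
        exact C.neg_mem hg' }
  have hN : N.Normal := ⟨fun n hn g => by
    refine ⟨by simp [hn.1], ?_⟩
    have : (fun k => b k (g * n * g⁻¹)) = fun k => α g (b k n) :=
      funext fun k => (hb k).map_conj g hn.1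
    rw [this]
    exact hC g _ hn.2⟩
  exact (Subgroup.normalClosure_le_normal (N := N)
    (fun r hr => ⟨htriv r (Subgroup.subset_normalClosure hr), hR r hr⟩) hn).2

/-- A crossed homomorphism that vanishes on the relators descends to the presented group. -/
theorem exists_descend {p : G →* Γ} (hp : Function.Surjective p) {R : Set G}
    (hR : Subgroup.normalClosure R = p.ker) {π : BanachRep Γ 𝕜 E} {b : G → E}
    (hb : IsCrossedHom (π.comp p) b) (hbR : ∀ r ∈ R, b r = 0) :
    ∃ b' : Γ → E, IsCrossedHom π b' ∧ ∀ g, b' (p g) = b g := by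
  have hker : ∀ n, p n = 1 → b n = 0 := by
    intro n hn
    have := mem_of_mem_normalClosure (ι := Unit) (b := fun _ => b) (fun _ => hb) ⊥
      (fun g f hf => by
        rw [AddSubgroup.mem_bot] at hf ⊢
        subst hf
        funext k
        simp)
      (R := R) (fun n hn => by
        rw [hR, MonoidHom.mem_ker] at hn
        rw [MonoidHom.comp_apply, hn, _root_.map_one])
      (fun r hr => by
        rw [AddSubgroup.mem_bot]
        funext k
        exact hbR r hr) (n := n) (by rwa [hR, MonoidHom.mem_ker])
    rw [AddSubgroup.mem_bot] at this
    exact congrFun this ()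
  have hfac : ∀ g h, p g = p h → b g = b h := by
    intro g h hgh
    have h1 : p (g * h⁻¹) = 1 := by rw [_root_.map_mul, _root_.map_inv, hgh, mul_inv_cancel]
    have h2 := hb.map_mul_inv g h
    rw [hker _ h1, MonoidHom.comp_apply, h1, _root_.map_one] at h2
    exact (sub_eq_zero.1 h2.symm)
  have hval : ∀ g, b (Function.surjInv hp (p g)) = b g := fun g =>
    hfac _ _ (Function.surjInv_eq hp _)
  refine ⟨fun γ => b (Function.surjInv hp γ), fun g h => ?_, hval⟩
  obtain ⟨g, rfl⟩ := hp g
  obtain ⟨h, rfl⟩ := hp h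
  simp only [← _root_.map_mul, hval]
  exact hb g h

end IsCrossedHom

/-- A vector `v` is a fixed point of the affine action `w ↦ π g w + b g` exactly when `b` is the
principal crossed homomorphism of `-v`. -/
theorem affineFixedPointProperty_iff (π : BanachRep Γ 𝕜 E) :
    AffineFixedPointProperty π ↔
      ∀ b : Γ → E, IsCrossedHom π b → ∃ v : E, ∀ g, b g = π g v - v := by
  constructor
  · intro h b hb
    let A : Γ →* (E ≃ᵃ[𝕜] E) :=
      { toFun := fun g => (π g).toLinearEquiv.toAffineEquiv.trans
          (AffineEquiv.constVAdd 𝕜 E (b g))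
        map_one' := by
          ext v
          simp only [map_one, hb.map_one]
          exact zero_add v
        map_mul' := fun g h => by
          ext v
          change b (g * h) + π (g * h) v = b g + π g (b h + π h v)
          rw [hb g h, map_add, map_mul, add_assoc]
          rfl }
    obtain ⟨v, hv⟩ := h A fun g => by
      rfl
    refine ⟨-v, fun g => ?_⟩
    have h1 : b g + π g v = v := hv g
    rw [map_neg]
    nth_rw 2 [← h1]
    abel
  · intro h A hA
    have key : ∀ g v, A g v = π g v + A g 0 := fun g v => by
      have h1 := (A g).map_vadd 0 v
      rw [hA g] at h1
      simpa using h1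
    obtain ⟨v, hv⟩ := h (fun g => A g 0) fun g k => by
      change A (g * k) 0 = A g 0 + π g (A k 0)
      rw [map_mul, add_comm, ← key g (A k 0)]
      rfl
    refine ⟨-v, fun g => ?_⟩
    rw [key, hv, map_neg]
    abel

end CrossedHom

/-! ### Fox derivatives -/

section Fox

variable {G : Type*} [Group G] {X : Type*} {𝕜 : Type*} [RCLike 𝕜]
  {E : Type*} [NormedAddCommGroup E] [NormedSpace 𝕜 E]

/-- The crossed homomorphism of a free group with prescribed values `x` on the generators: the
orbit map of `0` under the affine action in which the generator `i` acts by `v ↦ α i v + x i`. -/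
def crossedLift (α : BanachRep (FreeGroup X) 𝕜 E) (x : X → E) (w : FreeGroup X) : E :=
  FreeGroup.lift (fun i => ((α (FreeGroup.of i)).toLinearEquiv.toEquiv.trans
    (Equiv.addRight (x i)) : Equiv.Perm E)) w 0

theorem crossedLift_of (α : BanachRep (FreeGroup X) 𝕜 E) (x : X → E) (i : X) :
    crossedLift α x (FreeGroup.of i) = x i := by
  simp [crossedLift]

theorem isCrossedHom_crossedLift (α : BanachRep (FreeGroup X) 𝕜 E) (x : X → E) :
    IsCrossedHom α (crossedLift α x) := by
  have key : ∀ w v, FreeGroup.lift (fun i => ((α (FreeGroup.of i)).toLinearEquiv.toEquiv.trans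
      (Equiv.addRight (x i)) : Equiv.Perm E)) w v = α w v + crossedLift α x w := by
    intro w
    unfold crossedLift
    induction w using FreeGroup.induction_on with
    | C1 =>
      simp only [map_one]
      exact fun v => (add_zero v).symm
    | of i => simp
    | inv_of i ih =>
      intro v
      have hinv : ∀ y : E, (α (FreeGroup.of i)) ((α (FreeGroup.of i))⁻¹ y) = y :=
        fun y => (α (FreeGroup.of i)).apply_symm_apply y
      rw [map_inv, Equiv.Perm.inv_eq_iff_eq, ih, map_add, map_inv, hinv, add_assoc, ← ih,
        ← Equiv.Perm.mul_apply, mul_inv_cancel, Equiv.Perm.one_apply, add_zero]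
    | mul a b ha hb =>
      intro v
      have h1 : α (a * b) v = α a (α b v) := by rw [map_mul]; rfl
      rw [map_mul, Equiv.Perm.mul_apply, hb, ha, Equiv.Perm.mul_apply,
        ha ((FreeGroup.lift _ : _ →* Equiv.Perm E) b 0), map_add, h1, add_assoc]
  intro a b
  rw [crossedLift, map_mul, Equiv.Perm.mul_apply, key a, add_comm]
  rfl

/-- The representation on operators `W →L[𝕜] E` by composition on the left. -/
def postcompRep (W : Type*) [NormedAddCommGroup W] [NormedSpace 𝕜 W] (α : BanachRep G 𝕜 E) :
    BanachRep G 𝕜 (W →L[𝕜] E) where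
  toFun g := (ContinuousLinearEquiv.refl 𝕜 W).arrowCongr (α g)
  map_one' := by rw [map_one]; rfl
  map_mul' g h := by rw [map_mul]; rfl

variable [Fintype X]

/-- The Fox derivatives `∂ w / ∂ i`, acting on `E` through `α` and gathered into one operator: it
maps `x` to the value at `w` of the crossed homomorphism with values `x` on the generators. -/
noncomputable def foxOperator (α : BanachRep (FreeGroup X) 𝕜 E) (w : FreeGroup X) :
    (X → E) →L[𝕜] E :=
  crossedLift (postcompRep (X → E) α) (fun i => ContinuousLinearMap.proj i) w

theorem isCrossedHom_postcompRep_foxOperator (α : BanachRep (FreeGroup X) 𝕜 E) :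
    IsCrossedHom (postcompRep (X → E) α) (foxOperator α) :=
  isCrossedHom_crossedLift _ _

theorem foxOperator_of (α : BanachRep (FreeGroup X) 𝕜 E) (i : X) :
    foxOperator α (FreeGroup.of i) = ContinuousLinearMap.proj i :=
  crossedLift_of _ _ _

theorem isCrossedHom_foxOperator_apply (α : BanachRep (FreeGroup X) 𝕜 E) (x : X → E) :
    IsCrossedHom α fun w => foxOperator α w x := fun u v =>
  DFunLike.congr_fun (isCrossedHom_postcompRep_foxOperator α u v) x

theorem IsCrossedHom.foxOperator_apply {α : BanachRep (FreeGroup X) 𝕜 E} {b : FreeGroup X → E}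
    (hb : IsCrossedHom α b) (w : FreeGroup X) :
    foxOperator α w (fun i => b (FreeGroup.of i)) = b w :=
  congrFun ((isCrossedHom_foxOperator_apply α _).eq_of_eqOn_of hb fun i => by
    rw [foxOperator_of]; rfl) w

variable {Γ : Type*} [Group Γ]

/-- The operator `E → (X → E)` of the presentation complex, `v ↦ (π i v - v)_i`. -/
def generatorOperator (p : FreeGroup X →* Γ) (π : BanachRep Γ 𝕜 E) : E →L[𝕜] (X → E) :=
  ContinuousLinearMap.pi fun i =>
    (π (p (FreeGroup.of i)) : E →L[𝕜] E) - ContinuousLinearMap.id 𝕜 E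

/-- The operator `(X → E) → (R → E)` of the presentation complex, given by the Fox derivatives of
the relators. -/
noncomputable def relatorOperator (p : FreeGroup X →* Γ) (R : Set (FreeGroup X))
    (π : BanachRep Γ 𝕜 E) : (X → E) →L[𝕜] (R → E) :=
  ContinuousLinearMap.pi fun r => foxOperator (π.comp p) r

theorem foxOperator_generatorOperator (p : FreeGroup X →* Γ) (π : BanachRep Γ 𝕜 E) (v : E)
    (w : FreeGroup X) :
    foxOperator (π.comp p) w (generatorOperator p π v) = π (p w) v - v :=
  (IsCrossedHom.principal (π.comp p) v).foxOperator_apply w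

theorem relatorOperator_generatorOperator {p : FreeGroup X →* Γ} {R : Set (FreeGroup X)}
    (hR : Subgroup.normalClosure R = p.ker) (π : BanachRep Γ 𝕜 E) (v : E) :
    relatorOperator p R π (generatorOperator p π v) = 0 := by
  funext r
  have h1 : p r = 1 := by
    rw [← MonoidHom.mem_ker, ← hR]
    exact Subgroup.subset_normalClosure r.2
  change foxOperator (π.comp p) r (generatorOperator p π v) = 0
  rw [foxOperator_generatorOperator, h1, map_one]
  exact sub_self v

/-- The fixed point property is exactness of the presentation complex in the middle. -/
theorem affineFixedPointProperty_iff_exact {p : FreeGroup X →* Γ} (hp : Function.Surjective p)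
    {R : Set (FreeGroup X)} (hR : Subgroup.normalClosure R = p.ker) (π : BanachRep Γ 𝕜 E) :
    AffineFixedPointProperty π ↔
      ∀ x, relatorOperator p R π x = 0 → ∃ v, generatorOperator p π v = x := by
  rw [affineFixedPointProperty_iff]
  constructor
  · intro h x hx
    obtain ⟨b, hb, hbp⟩ := (isCrossedHom_foxOperator_apply (π.comp p) x).exists_descend hp hR
      (fun r hr => congrFun hx ⟨r, hr⟩)
    obtain ⟨v, hv⟩ := h b hb
    refine ⟨v, funext fun i => ?_⟩
    have h1 := hbp (FreeGroup.of i)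
    rw [foxOperator_of, hv] at h1
    exact h1
  · intro h b hb
    have hfox := (hb.comp p).foxOperator_apply
    obtain ⟨v, hv⟩ := h (fun i => b (p (FreeGroup.of i))) (by
      funext r
      have h1 : p r = 1 := by
        rw [← MonoidHom.mem_ker, ← hR]
        exact Subgroup.subset_normalClosure r.2
      exact (hfox r).trans (by rw [Function.comp_apply, h1, hb.map_one]; rfl))
    refine ⟨v, fun g => ?_⟩
    obtain ⟨w, rfl⟩ := hp g
    rw [← foxOperator_generatorOperator, hv]
    exact (hfox w).symm

end Fox

/-! ### Reduced second cohomology -/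

section Reduced

open Filter Topology

variable {Γ : Type*} [Group Γ] {𝕜 : Type*} [RCLike 𝕜]
  {E : Type*} [NormedAddCommGroup E] [NormedSpace 𝕜 E]

/-- If `H²` is reduced, a pointwise limit of coboundaries is a coboundary. -/
theorem IsReducedGroupH₂.exists_eq_groupD₁ {π : BanachRep Γ 𝕜 E} (hred : IsReducedGroupH₂ π)
    {β : ℕ → Γ → E} {c : Γ × Γ → E}
    (hc : ∀ q, Tendsto (fun k => groupD₁ π (β k) q) atTop (𝓝 (c q))) :
    ∃ b : Γ → E, groupD₁ π b = c := by
  have hcZ : c ∈ groupZ₂ π := by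
    rw [groupZ₂, LinearMap.mem_ker]
    funext q
    have h1 : Tendsto (fun k => groupD₂ π (groupD₁ π (β k)) q) atTop (𝓝 (groupD₂ π c q)) :=
      (((((π q.1).continuous.tendsto _).comp (hc _)).sub (hc _)).add (hc _)).sub (hc _)
    have h2 : ∀ k, groupD₂ π (groupD₁ π (β k)) q = 0 := fun k =>
      congrFun (LinearMap.mem_ker.1 (groupD₁_mem_groupZ₂ π (β k))) q
    simp only [h2] at h1
    exact tendsto_nhds_unique h1 tendsto_const_nhds
  have hcl : (⟨c, hcZ⟩ : groupZ₂ π) ∈ (groupB₂ π).topologicalClosure := by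
    refine mem_closure_of_tendsto (b := atTop)
      (f := fun k => (⟨groupD₁ π (β k), groupD₁_mem_groupZ₂ π (β k)⟩ : groupZ₂ π)) ?_
      (Eventually.of_forall fun k => ⟨β k, rfl⟩)
    rw [tendsto_subtype_rng, tendsto_pi_nhds]
    exact hc
  have hB : (⟨c, hcZ⟩ : groupZ₂ π) ∈ groupB₂ π := by
    rw [← Submodule.Quotient.mk_eq_zero]
    apply hred
    rw [map_zero]
    exact (Submodule.Quotient.mk_eq_zero _).2 hcl
  obtain ⟨b, hb⟩ := hB
  exact ⟨b, congrArg Subtype.val hb⟩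

/-- Reducedness of `H²` makes the relator operator an operator with closed range. -/
theorem isClosed_range_relatorOperator {X : Type*} [Fintype X] {p : FreeGroup X →* Γ}
    (hp : Function.Surjective p) {R : Set (FreeGroup X)} [Finite R]
    (hR : Subgroup.normalClosure R = p.ker) {π : BanachRep Γ 𝕜 E} (hred : IsReducedGroupH₂ π) :
    IsClosed (Set.range (relatorOperator p R π)) := by
  cases nonempty_fintype R
  rw [← closure_subset_iff_isClosed]
  intro y hy
  obtain ⟨z, hz, hzy⟩ := mem_closure_iff_seq_limit.1 hy
  choose x hx using hz
  let b : ℕ → FreeGroup X → E := fun k w => foxOperator (π.comp p) w (x k)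
  have hb : ∀ k, IsCrossedHom (π.comp p) (b k) := fun k => isCrossedHom_foxOperator_apply _ _
  have hbR : ∀ r : R, Tendsto (fun k => b k r) atTop (𝓝 (y r)) := fun r => by
    have h1 := tendsto_pi_nhds.1 hzy r
    simp only [← hx] at h1
    exact h1
  let C : AddSubgroup (ℕ → E) :=
    { carrier := {f | ∃ l, Tendsto f atTop (𝓝 l)}
      zero_mem' := ⟨0, tendsto_const_nhds⟩
      add_mem' := by
        rintro f g ⟨l, hl⟩ ⟨m, hm⟩
        exact ⟨l + m, hl.add hm⟩
      neg_mem' := by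
        rintro f ⟨l, hl⟩
        exact ⟨-l, hl.neg⟩ }
  have hlim : ∀ n, p n = 1 → ∃ l, Tendsto (fun k => b k n) atTop (𝓝 l) := fun n hn =>
    IsCrossedHom.mem_of_mem_normalClosure hb C
      (fun g f ⟨l, hl⟩ => ⟨π (p g) l, ((π (p g)).continuous.tendsto l).comp hl⟩)
      (R := R) (fun n hn => by
        rw [hR, MonoidHom.mem_ker] at hn
        rw [MonoidHom.comp_apply, hn, map_one])
      (fun r hr => ⟨_, hbR ⟨r, hr⟩⟩) (by rwa [hR, MonoidHom.mem_ker])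
  choose! φ hφ using hlim
  have hφmul : ∀ m n, p m = 1 → p n = 1 → φ (m * n) = φ m + φ n := fun m n hm hn => by
    refine tendsto_nhds_unique (hφ (m * n) (by rw [map_mul, hm, hn, one_mul])) ?_
    refine ((hφ m hm).add (hφ n hn)).congr fun k => ?_
    rw [hb k m n, MonoidHom.comp_apply, hm, map_one]
    rfl
  have hφconj : ∀ w n, p n = 1 → φ (w * n * w⁻¹) = π (p w) (φ n) := fun w n hn => by
    refine tendsto_nhds_unique (hφ (w * n * w⁻¹) (by simp [hn])) ?_
    refine (((π (p w)).continuous.tendsto _).comp (hφ n hn)).congr fun k => ?_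
    exact ((hb k).map_conj w (by rw [MonoidHom.comp_apply, hn, map_one])).symm
  let σ : Γ → FreeGroup X := Function.surjInv hp
  have hσ : ∀ g, p (σ g) = g := Function.surjInv_eq hp
  have hσc : ∀ g h, p (σ g * σ h * (σ (g * h))⁻¹) = 1 := fun g h => by simp [hσ]
  have hσ1 : ∀ w, p (w * (σ (p w))⁻¹) = 1 := fun w => by simp [hσ]
  obtain ⟨β, hβ⟩ := hred.exists_eq_groupD₁ (β := fun k g => b k (σ g))
    (c := fun q => φ (σ q.1 * σ q.2 * (σ (q.1 * q.2))⁻¹)) (fun q => by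
      refine (hφ _ (hσc q.1 q.2)).congr fun k => ?_
      rw [(hb k).map_mul_inv, MonoidHom.comp_apply, hσc, map_one, hb k (σ q.1),
        MonoidHom.comp_apply, hσ]
      change b k (σ q.1) + π q.1 (b k (σ q.2)) - b k (σ (q.1 * q.2)) =
        π q.1 (b k (σ q.2)) - b k (σ (q.1 * q.2)) + b k (σ q.1)
      abel)
  have hβ' : ∀ g h, π g (β h) - β (g * h) + β g = φ (σ g * σ h * (σ (g * h))⁻¹) := fun g h =>
    congrFun hβ (g, h)
  -- The extension of `φ` to a crossed homomorphism of the free group.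
  have hext : IsCrossedHom (π.comp p) fun w => φ (w * (σ (p w))⁻¹) + β (p w) := by
    intro u v
    have hsplit : u * v * (σ (p (u * v)))⁻¹ =
        u * (σ (p u))⁻¹ * (σ (p u) * (v * (σ (p v))⁻¹) * (σ (p u))⁻¹ *
          (σ (p u) * σ (p v) * (σ (p u * p v))⁻¹)) := by
      rw [map_mul]; group
    have h1 : p (σ (p u) * (v * (σ (p v))⁻¹) * (σ (p u))⁻¹) = 1 := by simp [hσ]
    have h2 := hσc (p u) (p v)
    simp only [hsplit]
    rw [hφmul _ _ (hσ1 u) (by rw [map_mul, h1, h2, one_mul]), hφmul _ _ h1 h2,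
      hφconj _ _ (hσ1 v), ← hβ', hσ, map_mul, MonoidHom.comp_apply, map_add]
    abel
  refine ⟨_, funext fun r => (hext.foxOperator_apply r).trans ?_⟩
  have hr : p r = 1 := by
    rw [← MonoidHom.mem_ker, ← hR]
    exact Subgroup.subset_normalClosure r.2
  have h1 : φ r = y r := tendsto_nhds_unique (hφ r hr) (hbR r)
  have h2 : φ (r * (σ 1)⁻¹) + φ (σ 1) = φ r := by
    rw [← hφmul _ _ (by simp [hσ, hr]) (hσ 1), inv_mul_cancel_right]
  have h3 : β 1 = φ (σ 1) := by
    have h4 := hβ' 1 1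
    rw [one_mul, map_one, mul_inv_cancel_right] at h4
    exact (sub_add_cancel (β 1) (β 1)).symm.trans h4
  rw [hr, h3, h2, h1]

end Reduced

/-! ### Continuity in the representation -/

section Deformation

open Filter Topology

variable {Γ : Type*} [Group Γ] {𝕜 : Type*} [RCLike 𝕜]
  {E : Type*} [NormedAddCommGroup E] [NormedSpace 𝕜 E]

/-- The filter of representations close to `π` on `S`, generated by the sets of
`ε`-deformations. -/
def deformationFilter (S : Set Γ) (π : BanachRep Γ 𝕜 E) : Filter (BanachRep Γ 𝕜 E) :=
  ⨅ (ε : ℝ) (_ : 0 < ε), 𝓟 {ρ | IsDeformation S ε π ρ}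

theorem hasBasis_deformationFilter (S : Set Γ) (π : BanachRep Γ 𝕜 E) :
    (deformationFilter S π).HasBasis (fun ε : ℝ => 0 < ε) fun ε => {ρ | IsDeformation S ε π ρ} := by
  refine hasBasis_biInf_principal ?_ ⟨1, one_pos (α := ℝ)⟩
  intro a ha b hb
  exact ⟨min a b, lt_min (α := ℝ) ha hb,
    fun ρ hρ s hs => (hρ s hs).trans (min_le_left _ _),
    fun ρ hρ s hs => (hρ s hs).trans (min_le_right _ _)⟩

/-- Convergence of representations on a generating set implies convergence at every element;
inverses are controlled by continuity of inversion on the units of a Banach algebra. -/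
theorem tendsto_deformationFilter [CompleteSpace E] {S : Set Γ} (hS : Subgroup.closure S = ⊤)
    (π : BanachRep Γ 𝕜 E) (g : Γ) :
    Tendsto (fun ρ : BanachRep Γ 𝕜 E => (ρ g : E →L[𝕜] E)) (deformationFilter S π)
      (𝓝 (π g : E →L[𝕜] E)) := by
  let u : BanachRep Γ 𝕜 E → Γ →* (E →L[𝕜] E)ˣ := fun ρ =>
    (ContinuousLinearEquiv.unitsEquiv 𝕜 E).symm.toMonoidHom.comp ρ
  suffices h : Tendsto (fun ρ => u ρ g) (deformationFilter S π) (𝓝 (u π g)) from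
    (Units.continuous_val.tendsto _).comp h
  have hg : g ∈ Subgroup.closure S := hS ▸ Subgroup.mem_top g
  induction hg using Subgroup.closure_induction with
  | mem s hs =>
    rw [Units.isOpenEmbedding_val.tendsto_nhds_iff]
    change Tendsto (fun ρ : BanachRep Γ 𝕜 E => (ρ s : E →L[𝕜] E)) _ (𝓝 (π s : E →L[𝕜] E))
    rw [Metric.tendsto_nhds]
    intro ε hε
    refine (hasBasis_deformationFilter S π).eventually_iff.2 ⟨ε / 2, half_pos hε, fun ρ hρ => ?_⟩
    rw [dist_comm, dist_eq_norm]
    exact (hρ s hs).trans_lt (half_lt_self hε)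
  | one => simpa using tendsto_const_nhds
  | mul a b _ _ ha hb => simpa only [map_mul] using ha.mul hb
  | inv a _ ha => simpa only [map_inv] using ha.inv

theorem tendsto_foxOperator [CompleteSpace E] {X : Type*} [Fintype X] (p : FreeGroup X →* Γ)
    {S : Set Γ} (hS : Subgroup.closure S = ⊤) (π : BanachRep Γ 𝕜 E) (w : FreeGroup X) :
    Tendsto (fun ρ : BanachRep Γ 𝕜 E => foxOperator (ρ.comp p) w) (deformationFilter S π)
      (𝓝 (foxOperator (π.comp p) w)) := by
  have hpost : ∀ (ρ : BanachRep Γ 𝕜 E) (u : FreeGroup X) (T : (X → E) →L[𝕜] E),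
      postcompRep (X → E) (ρ.comp p) u T = (ρ (p u) : E →L[𝕜] E).comp T := fun _ _ _ => rfl
  have hcomp : ∀ (u : FreeGroup X) {T : BanachRep Γ 𝕜 E → (X → E) →L[𝕜] E} {T₀ : (X → E) →L[𝕜] E},
      Tendsto T (deformationFilter S π) (𝓝 T₀) →
      Tendsto (fun ρ => (ρ (p u) : E →L[𝕜] E).comp (T ρ)) (deformationFilter S π)
        (𝓝 ((π (p u) : E →L[𝕜] E).comp T₀)) := fun u _ _ hT =>
    (isBoundedBilinearMap_comp.continuous.tendsto _).comp
      ((tendsto_deformationFilter hS π (p u)).prodMk_nhds hT)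
  induction w using FreeGroup.induction_on with
  | C1 =>
    simp only [(isCrossedHom_postcompRep_foxOperator _).map_one]
    exact tendsto_const_nhds
  | of i =>
    simp only [foxOperator_of]
    exact tendsto_const_nhds
  | inv_of i ih =>
    simp only [(isCrossedHom_postcompRep_foxOperator _).map_inv, hpost]
    exact (hcomp _ ih).neg
  | mul a b ha hb =>
    simp only [isCrossedHom_postcompRep_foxOperator _ a b, hpost]
    exact ha.add (hcomp _ hb)

/-- A product of finitely many convergent families of operators converges uniformly on the unit
ball. -/
theorem eventually_norm_pi_sub_le {α ι W : Type*} [Fintype ι] [NormedAddCommGroup W]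
    [NormedSpace 𝕜 W] {l : Filter α} {T : α → ι → W →L[𝕜] E} {T₀ : ι → W →L[𝕜] E}
    (h : ∀ i, Tendsto (fun a => T a i) l (𝓝 (T₀ i))) {δ : ℝ} (hδ : 0 < δ) :
    ∀ᶠ a in l, ∀ w, ‖ContinuousLinearMap.pi T₀ w - ContinuousLinearMap.pi (T a) w‖ ≤ δ * ‖w‖ := by
  have h1 : ∀ᶠ a in l, ∀ i, dist (T a i) (T₀ i) < δ :=
    eventually_all.2 fun i => Metric.tendsto_nhds.1 (h i) δ hδ
  filter_upwards [h1] with a ha w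
  refine (pi_norm_le_iff_of_nonneg (by positivity)).2 fun i => ?_
  have h2 := ha i
  rw [dist_comm, dist_eq_norm] at h2
  exact (T₀ i - T a i).le_of_opNorm_le h2.le w

end Deformation

theorem mainTheorem3 {Γ : Type*} [Group Γ] [Group.IsFinitelyPresented Γ]
    (S : Set Γ) (hSfin : S.Finite) (hSgen : Subgroup.closure S = ⊤)
    {𝕜 : Type*} [RCLike 𝕜]
    {E : Type*} [NormedAddCommGroup E] [NormedSpace 𝕜 E] [CompleteSpace E]
    (π : BanachRep Γ 𝕜 E)
    (hred : IsReducedGroupH₂ π)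
    (hfix : AffineFixedPointProperty π) :
    ∃ ε : ℝ, 0 < ε ∧
      ∀ ρ : BanachRep Γ 𝕜 E, IsDeformation S ε π ρ → AffineFixedPointProperty ρ := by
  obtain ⟨n, p, hp, R, hRfin, hR⟩ := Group.IsFinitelyPresented.out (G := Γ)
  have : Finite R := hRfin
  cases nonempty_fintype R
  have hexact := (affineFixedPointProperty_iff_exact hp hR π).1 hfix
  obtain ⟨δ, hδ, hstab⟩ := exists_forall_exact_of_close (generatorOperator p π)
    (relatorOperator p R π)
    (fun x => ⟨hexact x, fun ⟨v, hv⟩ => hv ▸ relatorOperator_generatorOperator hR π v⟩)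
    (isClosed_range_relatorOperator hp hR hred)
  have hA : ∀ᶠ ρ in deformationFilter S π,
      ∀ v, ‖generatorOperator p π v - generatorOperator p ρ v‖ ≤ δ * ‖v‖ :=
    eventually_norm_pi_sub_le
      (fun i => (tendsto_deformationFilter hSgen π _).sub tendsto_const_nhds) hδ
  have hB : ∀ᶠ ρ in deformationFilter S π,
      ∀ x, ‖relatorOperator p R π x - relatorOperator p R ρ x‖ ≤ δ * ‖x‖ :=
    eventually_norm_pi_sub_le (fun r : R => tendsto_foxOperator p hSgen π r) hδ
  obtain ⟨ε, hε, h⟩ := (hasBasis_deformationFilter S π).eventually_iff.1 (hA.and hB)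
  refine ⟨ε, hε, fun ρ hρ => ?_⟩
  obtain ⟨hAρ, hBρ⟩ := h hρ
  exact (affineFixedPointProperty_iff_exact hp hR ρ).2
    (hstab _ _ hAρ hBρ (relatorOperator_generatorOperator hR ρ))
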